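/- Graphs are finite multigraphs. A plane graph is a graph whose vertices are points of the sphere $S^2$ and whose edges are arcs in $S^2$ joining their ends, such that no edge contains a vertex other than its ends and distinct edges meet only in vertices. A graph is $2$-connected if it has no loops, has at least two vertices, is connected, and remains connected after the deletion of any single vertex. A graph $H$ is a minor of $G$ if $H$ is (isomorphic to) a subgraph of a graph obtained from $G$ by performing contractions of (non-loop) edges. For $k\ge 2$, let $C_k$ be the cycle with $k$ edges ($C_2$ being a pair of parallel edges), let $B_k$ be the bond with $k$ edges, that is, the graph with two vertices joined by $k$ parallel edges, let $C_k^+$ be the graph obtained from $C_k$ by adding exactly one edge parallel to one of its edges, and let $B_k^+$ be the graph obtained from $B_k$ by subdividing exactly one edge exactly once. For each integer $m\ge 3$ there is an integer $n_2=n_2(m)$ with the following property. Let $G$ be a $2$-connected plane graph with $n\ge n_2$ edges that contains neither $C_{m-1}^+$ nor $B_{m-1}^+$ as a minor. Then $G$ is (isomorphic to) either the cycle $C_n$ or the bond $B_n$. -/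

import Mathlib

/-! Multigraphs are Mathlib's `Graph α β`: a vertex set in `α`, an edge set in `β`, loops and
parallel edges allowed. -/

namespace PlaneMinor

open scoped Graph

/-- The unit sphere `S²` of `ℝ³`. -/
abbrev S2 : Type := Metric.sphere (0 : EuclideanSpace ℝ (Fin 3)) 1

/-- `A` is an arc in `S²` from `x` to `y`; if `x = y`, it is a simple closed curve through `x`. -/
def IsArc (A : Set S2) (x y : S2) : Prop :=
  ∃ γ : unitInterval → S2, Continuous γ ∧ Set.range γ = A ∧ γ 0 = x ∧ γ 1 = y ∧
    ∀ s t, γ s = γ t → s = t ∨ (s = 0 ∧ t = 1) ∨ (s = 1 ∧ t = 0)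

/-- A plane graph: a finite multigraph whose vertices are points of `S²`, and whose edges are arcs
(with their ends) in `S²`. An edge joins the two ends of the arc, it contains no
vertices other than its ends, and two distinct edges meet in vertices only. -/
structure IsPlane (G : Graph S2 (Set S2)) : Prop where
  finite_vertexSet : V(G).Finite
  finite_edgeSet : E(G).Finite
  isArc : ∀ e x y, G.IsLink e x y → IsArc e x y
  inc_of_mem : ∀ e ∈ E(G), ∀ v ∈ V(G), v ∈ e → G.Inc e v
  mem_of_mem_inter : ∀ e ∈ E(G), ∀ f ∈ E(G), e ≠ f → ∀ p ∈ e ∩ f, p ∈ V(G)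

/-- The graph `G` is nonempty, and any two vertices are joined by a walk. -/
def Connected {α β : Type*} (G : Graph α β) : Prop :=
  V(G).Nonempty ∧ ∀ x ∈ V(G), ∀ y ∈ V(G), Relation.ReflTransGen G.Adj x y

/-- 2-connectedness of a multigraph: there are no loops, there are at least two vertices, and the
graph is connected and remains so whenever a single vertex is deleted. (Bonds are 2-connected.) -/
structure TwoConnected {α β : Type*} (G : Graph α β) : Prop where
  loopless : G.Loopless
  nontrivial : V(G).Nontrivial
  connected : Connected G
  connected_deleteVerts : ∀ v ∈ V(G), Connected (G.deleteVerts {v})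

/-- `G` and `H` are isomorphic multigraphs. -/
def Isomorphic {α β α' β' : Type*} (G : Graph α β) (H : Graph α' β') : Prop :=
  ∃ (f : V(G) ≃ V(H)) (g : E(G) ≃ E(H)), ∀ (e : E(G)) (x y : V(G)),
    G.IsLink e x y ↔ H.IsLink (g e) (f x) (f y)

open Classical in
/-- `G'` arises from `G` by contracting one non-loop edge `e = xy`: the edge `e` is removed and
`y` is identified with `x`. Other edges joining `x` and `y` become loops. -/
def ContractsEdge {α β : Type*} (G G' : Graph α β) : Prop :=
  ∃ e x y, G.IsLink e x y ∧ x ≠ y ∧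
    G' = (G.deleteEdges {e}).map (fun v => if v = y then x else v)

/-- `H` is (isomorphic to) a minor of `G`: a subgraph of a graph obtained from `G` by performing
edge contractions. -/
def HasMinor {α β α' β' : Type*} (G : Graph α β) (H : Graph α' β') : Prop :=
  ∃ G' K : Graph α β, Relation.ReflTransGen ContractsEdge G G' ∧ K ≤ G' ∧ Isomorphic K H

/-- The cycle `C_k`: vertices `0, …, k-1` and edges `0, …, k-1`, where the edge `i` joins
`i` and `i + 1` modulo `k` (two parallel edges if `k = 2`). -/
def cycle (k : ℕ) : Graph ℕ ℕ where
  vertexSet := {i | i < k}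
  edgeSet := {i | i < k}
  IsLink i x y := i < k ∧ ((x = i ∧ y = (i + 1) % k) ∨ (x = (i + 1) % k ∧ y = i))
  isLink_symm := fun _ _ => ⟨fun _ _ h => ⟨h.1, h.2.symm.imp And.symm And.symm⟩⟩
  eq_or_eq_of_isLink_of_isLink := by
    rintro e x y v w ⟨-, h⟩ ⟨-, h'⟩
    omega
  edge_mem_iff_exists_isLink := fun i =>
    ⟨fun h => ⟨i, (i + 1) % k, h, Or.inl ⟨rfl, rfl⟩⟩, fun ⟨_, _, h⟩ => h.1⟩
  left_mem_of_isLink := by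
    rintro e x y ⟨h, ⟨rfl, -⟩ | ⟨rfl, -⟩⟩
    · exact h
    · exact Nat.mod_lt _ (by omega)

/-- The bond `B_k`: two vertices joined by `k` parallel edges. -/
def bond (k : ℕ) : Graph ℕ ℕ := Graph.banana 0 1 {i | i < k}

/-- The graph `G` with one further edge `none`, parallel to the edge `e₀` of `G`. -/
def addParallel {α β : Type*} (G : Graph α β) (e₀ : β) : Graph α (Option β) where
  vertexSet := V(G)
  IsLink e x y := G.IsLink (e.getD e₀) x y
  isLink_symm := fun _ _ => ⟨fun _ _ h => h.symm⟩
  eq_or_eq_of_isLink_of_isLink := fun _ _ _ _ _ h h' => h.left_eq_or_eq h'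
  left_mem_of_isLink := fun _ _ _ h => h.left_mem

/-- `C_k^+`: the cycle `C_k` with exactly one edge added, parallel to an edge of the cycle. -/
def cyclePlus (k : ℕ) : Graph ℕ (Option ℕ) := addParallel (cycle k) 0

/-- The graph `G` with the edge `e₀ = xy` subdivided once: `e₀` is replaced by an edge from `x` to
the new vertex `none` and an edge from `none` to `y`. The old vertices and edges are
`some v` and `Sum.inl e`; the two new edges are `Sum.inr x` and `Sum.inr y`, named after the old
end (so `e₀` should not be a loop). -/
def subdivide {α β : Type*} (G : Graph α β) (e₀ : β) : Graph (Option α) (β ⊕ α) where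
  vertexSet := insert none (some '' V(G))
  IsLink e x y := match e with
    | .inl e => e ≠ e₀ ∧ ∃ a b, G.IsLink e a b ∧ x = some a ∧ y = some b
    | .inr a => G.Inc e₀ a ∧ ((x = some a ∧ y = none) ∨ (x = none ∧ y = some a))
  isLink_symm := by
    rintro (e | a) -
    · exact ⟨fun x y ⟨h, a, b, hab, hx, hy⟩ => ⟨h, b, a, hab.symm, hy, hx⟩⟩
    · exact ⟨fun x y ⟨h, h'⟩ => ⟨h, h'.symm.imp And.symm And.symm⟩⟩
  eq_or_eq_of_isLink_of_isLink := by
    rintro (e | a) x y v w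
    · rintro ⟨-, a, b, hab, rfl, rfl⟩ ⟨-, c, d, hcd, rfl, rfl⟩
      exact (hab.left_eq_or_eq hcd).imp (congrArg some) (congrArg some)
    · rintro ⟨-, ⟨rfl, rfl⟩ | ⟨rfl, rfl⟩⟩ ⟨-, ⟨rfl, rfl⟩ | ⟨rfl, rfl⟩⟩ <;> simp
  left_mem_of_isLink := by
    rintro (e | a) x y
    · rintro ⟨-, a, b, hab, rfl, rfl⟩
      exact Or.inr ⟨a, hab.left_mem, rfl⟩
    · rintro ⟨h, ⟨rfl, rfl⟩ | ⟨rfl, rfl⟩⟩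
      · exact Or.inr ⟨a, h.vertex_mem, rfl⟩
      · exact Or.inl rfl

/-- `B_k^+`: the bond `B_k` with exactly one edge subdivided exactly once. -/
def bondPlus (k : ℕ) : Graph (Option ℕ) (ℕ ⊕ ℕ) := subdivide (bond k) 0

end PlaneMinor

/-! Put `k = m - 1`. A 2-connected graph on two vertices is a bond, so let `G` have at least three
vertices.

If a vertex `v` has degree at least `2 * k`, then `G - v` is connected and splits into two connected
parts, both adjacent to `v` and to each other. One of them receives at least `k` edges from `v`;
contracting each part to a vertex yields `B_k^+` (`hasMinor_bondPlus_of_degree`). Hence degrees are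
bounded.

With bounded degrees and many edges, some two vertices are at distance more than `2 * k`, and two
internally disjoint paths between them form a long cycle (`TwoConnected.exists_long_isCycleSeq`). If
some edge is off this cycle, 2-connectedness gives an ear. Contracting the ear to one edge, and a
stretch of the cycle between its ends to one edge parallel to it, leaves `C_k^+`
(`IsCycleSeq.hasMinor_cyclePlus`). So the cycle is all of `G`.

Both minors are exhibited by branch sets (`hasMinor_of_model`). -/

namespace PlaneMinor

open scoped Graph
open Relation

variable {α β α' β' : Type*}

/-! ### Walks inside a set of vertices. -/

/-- Adjacency in `G` between two vertices of the set `S`. -/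
def AdjIn (G : Graph α β) (S : Set α) (a b : α) : Prop := G.Adj a b ∧ a ∈ S ∧ b ∈ S

/-- Any two elements of the set `S` are joined by a walk of `G` inside `S`. -/
def ConnectedOn (G : Graph α β) (S : Set α) : Prop :=
  ∀ a ∈ S, ∀ b ∈ S, ReflTransGen (AdjIn G S) a b

lemma Isomorphic.symm {G : Graph α β} {H : Graph α' β'} (h : Isomorphic G H) : Isomorphic H G := by
  obtain ⟨f, g, h⟩ := h
  exact ⟨f.symm, g.symm, fun e x y => by simpa using (h (g.symm e) (f.symm x) (f.symm y)).symm⟩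

lemma AdjIn.symm {G : Graph α β} {S : Set α} {a b : α} (h : AdjIn G S a b) : AdjIn G S b a :=
  ⟨h.1.symm, h.2.2, h.2.1⟩

lemma reflTransGen_adjIn_symm {G : Graph α β} {S : Set α} {a b : α}
    (h : ReflTransGen (AdjIn G S) a b) : ReflTransGen (AdjIn G S) b a :=
  have : Std.Symm (AdjIn G S) := ⟨fun _ _ h => h.symm⟩
  ReflTransGen.stdSymm.symm _ _ h

lemma reflTransGen_adjIn_mono {G : Graph α β} {S T : Set α} (hST : S ⊆ T) {a b : α}
    (h : ReflTransGen (AdjIn G S) a b) : ReflTransGen (AdjIn G T) a b :=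
  ReflTransGen.mono (fun _ _ h => ⟨h.1, hST h.2.1, hST h.2.2⟩) _ _ h

lemma mem_of_reflTransGen_adjIn {G : Graph α β} {S : Set α} {a b : α}
    (h : ReflTransGen (AdjIn G S) a b) (ha : a ∈ S) : b ∈ S := by
  induction h with
  | refl => exact ha
  | tail _ h _ => exact h.2.2

lemma ConnectedOn.of_forall_reflTransGen {G : Graph α β} {S : Set α} (r : α)
    (h : ∀ a ∈ S, ReflTransGen (AdjIn G S) r a) : ConnectedOn G S :=
  fun a ha b hb => (reflTransGen_adjIn_symm (h a ha)).trans (h b hb)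

lemma connectedOn_singleton (G : Graph α β) (a : α) : ConnectedOn G {a} := by
  rintro x rfl y rfl
  exact .refl

lemma ConnectedOn.union {G : Graph α β} {S T : Set α} (hS : ConnectedOn G S)
    (hT : ConnectedOn G T) {a b : α} (ha : a ∈ S) (hb : b ∈ T) (hab : a = b ∨ G.Adj a b) :
    ConnectedOn G (S ∪ T) := by
  refine .of_forall_reflTransGen a fun c hc => ?_
  rcases hc with hc | hc
  · exact reflTransGen_adjIn_mono Set.subset_union_left (hS a ha c hc)
  · have h := reflTransGen_adjIn_mono (Set.subset_union_right (s := S)) (hT b hb c hc)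
    rcases hab with rfl | hab
    · exact h
    · exact .head ⟨hab, .inl ha, .inr hb⟩ h

lemma exists_ne_of_reflTransGen {r : α → α → Prop} {a b : α} (h : ReflTransGen r a b)
    (hab : a ≠ b) : ∃ c, c ≠ a ∧ r a c := by
  induction h using ReflTransGen.head_induction_on with
  | refl => exact (hab rfl).elim
  | @head a c hac _ ih =>
    by_cases hca : c = a
    · subst hca
      exact ih hab
    · exact ⟨c, hca, hac⟩

/-! ### Minors from contractions and branch sets. -/

open Classical in
/-- Contracting the (connected) fibres of a retraction `ρ` of the vertex set. -/
lemma exists_contraction {G : Graph α β} (hfin : V(G).Finite) (ρ : α → α)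
    (hmem : ∀ v ∈ V(G), ρ v ∈ V(G)) (hidem : ∀ v ∈ V(G), ρ (ρ v) = ρ v)
    (hconn : ∀ v ∈ V(G), ReflTransGen (AdjIn G {w | ρ w = ρ v}) (ρ v) v) :
    ∃ G' : Graph α β, ReflTransGen ContractsEdge G G' ∧ (∀ v ∈ V(G), ρ v ∈ V(G')) ∧
      ∀ e x y, G.IsLink e x y → ρ x ≠ ρ y → G'.IsLink e (ρ x) (ρ y) := by
  induction hn : V(G).ncard using Nat.strong_induction_on generalizing G with
  | _ n ih =>
  by_cases hid : ∀ v ∈ V(G), ρ v = v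
  · refine ⟨G, .refl, fun v hv => hmem v hv, fun e x y h _ => ?_⟩
    rwa [hid x h.left_mem, hid y h.right_mem]
  push Not at hid
  obtain ⟨v, hv, hne⟩ := hid
  -- The walk from `ρ v` to `v` in the fibre supplies an edge from `ρ v` to another vertex `y` of
  -- that fibre. Contracting it into `ρ v` lowers the number of vertices.
  obtain ⟨y, hyne, ⟨e, he⟩, -, hy⟩ := exists_ne_of_reflTransGen (hconn v hv) hne
  replace hy : ρ y = ρ v := hy
  have hρx := hidem v hv
  generalize ρ v = x at *
  set σ : α → α := fun v => if v = y then x else v with hσ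
  have hσy : σ y = x := by simp [hσ]
  have hσne : ∀ w, w ≠ y → σ w = w := fun w hw => by simp [hσ, hw]
  have hρσ : ∀ w, ρ (σ w) = ρ w := fun w => by
    by_cases hw : w = y
    · rw [hw, hσy, hρx, hy]
    · rw [hσne w hw]
  set G₁ := (G.deleteEdges {e}).map σ with hG₁
  have hV : ∀ w, w ∈ V(G₁) ↔ w ∈ V(G) ∧ w ≠ y := by
    intro w
    constructor
    · rintro ⟨u, hu, rfl⟩
      by_cases huy : u = y
      · rw [huy, hσy]
        exact ⟨he.left_mem, hyne.symm⟩
      · rw [hσne u huy]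
        exact ⟨hu, huy⟩
    · rintro ⟨hw, hwy⟩
      exact ⟨w, hw, hσne w hwy⟩
  have hlink : ∀ f a b, G.IsLink f a b → f ≠ e → G₁.IsLink f (σ a) (σ b) := fun f a b h hf =>
    Graph.IsLink.map σ (by simpa using ⟨h, hf⟩)
  have hstep : ContractsEdge G G₁ := ⟨e, x, y, he, hyne.symm, rfl⟩
  -- The deleted vertex `y` is not the representative of a fibre, so `ρ` restricts to a retraction
  -- of `V(G₁)`.
  have hfix : ∀ w ∈ V(G), ρ w ≠ y := fun w hw h => by
    have := hidem w hw
    rw [h, hy] at this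
    exact hyne this.symm
  have hsub : V(G₁) ⊂ V(G) :=
    ⟨fun w hw => ((hV w).1 hw).1, fun h => ((hV y).1 (h he.right_mem)).2 rfl⟩
  obtain ⟨G', hG', hmem', hlink'⟩ := ih _ (hn ▸ Set.ncard_lt_ncard hsub hfin)
    (hfin.subset hsub.subset)
    (fun w hw => (hV _).2 ⟨hmem w ((hV w).1 hw).1, hfix w ((hV w).1 hw).1⟩)
    (fun w hw => hidem w ((hV w).1 hw).1)
    (fun w hw => by
      obtain ⟨hw, hwy⟩ := (hV w).1 hw
      have key := hconn w hw
      suffices h : ReflTransGen (AdjIn G₁ {u | ρ u = ρ w}) (σ (ρ w)) (σ w) by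
        rwa [hσne (ρ w) (hfix w hw), hσne w hwy] at h
      -- The walk is pushed along `σ`; a step along the contracted edge becomes trivial.
      refine ReflTransGen.lift' σ ?_ _ _ key
      rintro a b ⟨⟨f, hf⟩, ha, hb⟩
      change ReflTransGen _ (σ a) (σ b)
      by_cases hfe : f = e
      · subst hfe
        obtain ⟨rfl, rfl⟩ | ⟨rfl, rfl⟩ := he.eq_and_eq_or_eq_and_eq hf
        · rw [hσy, hσne _ hyne.symm]
        · rw [hσy, hσne _ hyne.symm]
      · exact .single ⟨⟨f, hlink f a b hf hfe⟩, (hρσ a).trans ha, (hρσ b).trans hb⟩) rfl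
  refine ⟨G', .head hstep hG', fun w hw => ?_, fun f a b h hab => ?_⟩
  · rw [← hρσ]
    refine hmem' _ ⟨w, hw, rfl⟩
  · have hfe : f ≠ e := by
      rintro rfl
      obtain ⟨rfl, rfl⟩ | ⟨rfl, rfl⟩ := he.eq_and_eq_or_eq_and_eq h
      · exact hab (hρx.trans hy.symm)
      · exact hab (hy.trans hρx.symm)
    have := hlink' f _ _ (hlink f a b h hfe)
    rw [hρσ, hρσ] at this
    exact this hab

open Classical in
/-- A graph `H` is a minor of `G` if the vertices `x` of `H` are assigned disjoint connected branch
sets `B x` in `G`, and the edges of `H` are assigned distinct edges joining the branch sets. -/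
lemma hasMinor_of_model {G : Graph α β} {H : Graph α' β'} (hfin : V(G).Finite)
    (hH : H.Loopless) (B : α' → Set α) (r : α' → α) (j : β' → β)
    (hB : ∀ x ∈ V(H), B x ⊆ V(G)) (hr : ∀ x ∈ V(H), r x ∈ B x)
    (hconn : ∀ x ∈ V(H), ConnectedOn G (B x))
    (hdisj : ∀ x ∈ V(H), ∀ y ∈ V(H), ∀ v, v ∈ B x → v ∈ B y → x = y)
    (hj : Set.InjOn j E(H))
    (hlink : ∀ e x y, H.IsLink e x y → ∃ u ∈ B x, ∃ v ∈ B y, G.IsLink (j e) u v) :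
    HasMinor G H := by
  -- The retraction collapses each branch set to its root `r x` and fixes all other vertices.
  set ρ : α → α := fun v => if h : ∃ x ∈ V(H), v ∈ B x then r h.choose else v with hρ
  have hρB : ∀ x ∈ V(H), ∀ v ∈ B x, ρ v = r x := by
    intro x hx v hv
    have h : ∃ x ∈ V(H), v ∈ B x := ⟨x, hx, hv⟩
    simp only [hρ, dif_pos h]
    rw [hdisj _ h.choose_spec.1 x hx v h.choose_spec.2 hv]
  have hρn : ∀ v, (¬ ∃ x ∈ V(H), v ∈ B x) → ρ v = v := fun v hv => by
    simp only [hρ, dif_neg hv]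
  have hrinj : ∀ x ∈ V(H), ∀ y ∈ V(H), r x = r y → x = y := fun x hx y hy h =>
    hdisj x hx y hy _ (hr x hx) (h ▸ hr y hy)
  obtain ⟨G', hG', hmem, hlink'⟩ := exists_contraction (G := G) hfin ρ
    (fun v hv => by
      by_cases h : ∃ x ∈ V(H), v ∈ B x
      · obtain ⟨x, hx, hvx⟩ := h
        rw [hρB x hx v hvx]
        exact hB x hx (hr x hx)
      · rwa [hρn v h])
    (fun v hv => by
      by_cases h : ∃ x ∈ V(H), v ∈ B x
      · obtain ⟨x, hx, hvx⟩ := h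
        rw [hρB x hx v hvx, hρB x hx _ (hr x hx)]
      · rw [hρn v h, hρn v h])
    (fun v hv => by
      by_cases h : ∃ x ∈ V(H), v ∈ B x
      · obtain ⟨x, hx, hvx⟩ := h
        rw [hρB x hx v hvx]
        exact reflTransGen_adjIn_mono (fun w hw => hρB x hx w hw)
          (hconn x hx _ (hr x hx) v hvx)
      · rw [hρn v h])
  have hl : ∀ e x y, H.IsLink e x y → G'.IsLink (j e) (r x) (r y) := by
    intro e x y h
    obtain ⟨u, hu, v, hv, huv⟩ := hlink e x y h
    have := hlink' _ _ _ huv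
    rw [hρB x h.left_mem u hu, hρB y h.right_mem v hv] at this
    exact this fun h' => h.ne (hrinj _ h.left_mem _ h.right_mem h')
  let K : Graph α β :=
    { vertexSet := r '' V(H)
      IsLink := fun f u v => ∃ e x y, H.IsLink e x y ∧ j e = f ∧ r x = u ∧ r y = v
      isLink_symm := fun f _ => ⟨fun u v ⟨e, x, y, h, h1, h2, h3⟩ => ⟨e, y, x, h.symm, h1, h3, h2⟩⟩
      eq_or_eq_of_isLink_of_isLink := by
        rintro f u v u' v' ⟨e, x, y, h, rfl, rfl, rfl⟩ ⟨e', x', y', h', he, rfl, rfl⟩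
        obtain rfl := hj h'.edge_mem h.edge_mem he
        exact (h.left_eq_or_eq h').imp (congrArg r) (congrArg r)
      left_mem_of_isLink := by
        rintro f u v ⟨e, x, y, h, rfl, rfl, rfl⟩
        exact ⟨x, h.left_mem, rfl⟩ }
  refine ⟨G', K, hG', ⟨?_, ?_⟩, ?_⟩
  · rintro _ ⟨x, hx, rfl⟩
    rw [← hρB x hx _ (hr x hx)]
    exact hmem _ (hB x hx (hr x hx))
  · rintro f u v ⟨e, x, y, h, rfl, rfl, rfl⟩
    exact hl e x y h
  · have hjmem : ∀ e : E(H), j e ∈ E(K) := by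
      rintro ⟨e, he⟩
      obtain ⟨x, y, h⟩ := H.exists_isLink_of_mem_edgeSet he
      exact (show K.IsLink (j e) (r x) (r y) from ⟨e, x, y, h, rfl, rfl, rfl⟩).edge_mem
    let f : V(H) ≃ V(K) := Equiv.ofBijective (fun x => ⟨r x, x, x.2, rfl⟩)
      ⟨fun x y h => Subtype.ext (hrinj x x.2 y y.2 (congrArg Subtype.val h)), by
        rintro ⟨_, x, hx, rfl⟩
        exact ⟨⟨x, hx⟩, rfl⟩⟩
    let g : E(H) ≃ E(K) := Equiv.ofBijective (fun e => ⟨j e, hjmem e⟩)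
      ⟨fun x y h => Subtype.ext (hj x.2 y.2 (congrArg Subtype.val h)), by
        rintro ⟨f, hf⟩
        obtain ⟨u, v, e, x, y, h, rfl, rfl, rfl⟩ := K.exists_isLink_of_mem_edgeSet hf
        exact ⟨⟨e, h.edge_mem⟩, rfl⟩⟩
    refine Isomorphic.symm ⟨f, g, fun e x y => ⟨fun h => ⟨e, x, y, h, rfl, rfl, rfl⟩, ?_⟩⟩
    rintro ⟨e', x', y', h, he, hx, hy⟩
    obtain rfl := hj h.edge_mem e.2 he
    obtain rfl := hrinj _ h.left_mem x x.2 hx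
    obtain rfl := hrinj _ h.right_mem y y.2 hy
    exact h

/-! ### Connectivity and partitions into connected sets. -/

lemma Connected.connectedOn {G : Graph α β} (h : Connected G) : ConnectedOn G V(G) :=
  fun a ha b hb => ReflTransGen.mono (fun _ _ h => ⟨h, h.left_mem, h.right_mem⟩) _ _ (h.2 a ha b hb)

lemma TwoConnected.connectedOn_sdiff {G : Graph α β} (h : TwoConnected G) {v : α} (hv : v ∈ V(G)) :
    ConnectedOn G (V(G) \ {v}) := by
  have h := (h.connected_deleteVerts v hv).connectedOn
  rw [Graph.vertexSet_deleteVerts] at h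
  exact fun a ha b hb => ReflTransGen.mono (fun _ _ h => ⟨h.1.mono Graph.deleteVerts_le, h.2⟩) _ _
    (h a ha b hb)

lemma exists_adj_of_reflTransGen {G : Graph α β} {S T : Set α} {a b : α}
    (h : ReflTransGen (AdjIn G S) a b) (ha : a ∈ T) (hb : b ∉ T) :
    ∃ c d, c ∈ T ∧ d ∉ T ∧ AdjIn G S c d := by
  induction h with
  | refl => exact (hb ha).elim
  | @tail c d _ hcd ih =>
    by_cases hc : c ∈ T
    · exact ⟨c, d, hc, hb, hcd⟩
    · exact ih hc

/-- The set of vertices reachable from `a` inside `S`. -/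
def reachSet (G : Graph α β) (S : Set α) (a : α) : Set α := {u | ReflTransGen (AdjIn G S) a u}

lemma reachSet_subset {G : Graph α β} {S : Set α} {a : α} (ha : a ∈ S) : reachSet G S a ⊆ S :=
  fun _ hu => mem_of_reflTransGen_adjIn hu ha

lemma connectedOn_reachSet (G : Graph α β) (S : Set α) (a : α) :
    ConnectedOn G (reachSet G S a) := by
  refine .of_forall_reflTransGen a fun b hb => ?_
  replace hb : ReflTransGen (AdjIn G S) a b := hb
  induction hb with
  | refl => exact .refl
  | @tail c d hc hcd ih => exact ih.tail ⟨hcd.1, hc, hc.tail hcd⟩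

/-- Two vertices of a connected set lie in different parts of a partition into connected sets. -/
lemma ConnectedOn.exists_partition {G : Graph α β} {Y : Set α} (hY : ConnectedOn G Y) {a b : α}
    (ha : a ∈ Y) (hb : b ∈ Y) (hab : a ≠ b) :
    ∃ A B, a ∈ A ∧ b ∈ B ∧ Disjoint A B ∧ A ∪ B = Y ∧ ConnectedOn G A ∧ ConnectedOn G B := by
  -- `B` is the component of `b` in `Y \ {a}`, and `A` is the rest of `Y`.
  have hsub : reachSet G (Y \ {a}) b ⊆ Y \ {a} := reachSet_subset ⟨hb, hab.symm⟩
  have haA : a ∈ Y \ reachSet G (Y \ {a}) b := ⟨ha, fun h => (hsub h).2 rfl⟩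
  refine ⟨Y \ reachSet G (Y \ {a}) b, reachSet G (Y \ {a}) b, haA, .refl,
    Set.disjoint_sdiff_left, Set.sdiff_union_of_subset fun u hu => (hsub hu).1, ?_,
    connectedOn_reachSet _ _ _⟩
  refine .of_forall_reflTransGen a fun u hu => reflTransGen_adjIn_symm ?_
  have h := hY u hu.1 a ha
  induction h using ReflTransGen.head_induction_on with
  | refl => exact .refl
  | @head u w huw _ ih =>
    by_cases hua : u = a
    · rw [hua]
    -- A walk from `A` to `a` cannot enter the component before it reaches `a`: the vertex from
    -- which it enters would belong to the component.
    have hw : w ∉ reachSet G (Y \ {a}) b := by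
      intro hw
      exact hu.2 (ReflTransGen.tail hw ⟨huw.1.symm, hsub hw, hu.1, hua⟩)
    exact .head ⟨huw.1, hu, huw.2.2, hw⟩ (ih ⟨huw.2.2, hw⟩)

/-! ### The minor `B_k^+` at a vertex of large degree. -/

lemma exists_injOn_of_le_ncard {S : Set β} {n : ℕ} (b : β) (h : n ≤ S.ncard) :
    ∃ g : ℕ → β, Set.InjOn g {i | i < n} ∧ ∀ i < n, g i ∈ S := by
  obtain ⟨T, hT, hn⟩ := Set.exists_subset_card_eq h
  -- An infinite set has `ncard` zero, so finiteness of `T` can be read off only for positive `n`.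
  rcases Nat.eq_zero_or_pos n with rfl | hpos
  · exact ⟨fun _ => b, fun i hi => (Nat.not_lt_zero i hi).elim, fun i hi => by omega⟩
  have hfin : T.Finite := Set.finite_of_ncard_pos (by omega)
  have hc : hfin.toFinset.card = n := by rw [← hn, Set.ncard_eq_toFinset_card T hfin]
  let e := hfin.toFinset.equivFinOfCardEq hc
  refine ⟨fun i => if h : i < n then e.symm ⟨i, h⟩ else b, fun i hi j hj hij => ?_, fun i hi => ?_⟩
  · replace hi : i < n := hi
    replace hj : j < n := hj
    simp only [dif_pos hi, dif_pos hj] at hij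
    simpa using e.symm.injective (Subtype.ext hij)
  · simp only [dif_pos hi]
    exact hT (hfin.mem_toFinset.1 (e.symm ⟨i, hi⟩).2)

lemma bond_loopless (k : ℕ) : (bond k).Loopless :=
  ⟨fun e x h => by simp [bond] at h⟩

lemma bondPlus_loopless (k : ℕ) : (bondPlus k).Loopless := by
  refine ⟨?_⟩
  rintro (e | a) x h
  · obtain ⟨-, a, b, hab, rfl, h⟩ := h
    obtain rfl := Option.some_injective _ h
    exact (bond_loopless k).not_isLoopAt _ _ hab
  · obtain ⟨-, ⟨rfl, h⟩ | ⟨rfl, h⟩⟩ := h <;> simp at h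

/-- The branch sets of the two ends are `{v}` and `B`, and that of the subdividing vertex is `A`.
The edges `e` and `f` form the subdivided edge; `k - 1` edges from `v` to `B` are the others. -/
lemma hasMinor_bondPlus_of_parts {G : Graph α β} (hfin : V(G).Finite) {k : ℕ} {v : α}
    {A B : Set α} (hv : v ∈ V(G)) (hAV : A ⊆ V(G)) (hBV : B ⊆ V(G)) (hvA : v ∉ A) (hvB : v ∉ B)
    (hAB : Disjoint A B) (hA : ConnectedOn G A) (hB : ConnectedOn G B)
    {e f : β} (he : ∃ a ∈ A, G.IsLink e v a) (hf : ∃ a ∈ A, ∃ b ∈ B, G.IsLink f a b)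
    (hk : k - 1 ≤ {d | ∃ b ∈ B, G.IsLink d v b}.ncard) : HasMinor G (bondPlus k) := by
  obtain ⟨g, hg, hgB⟩ := exists_injOn_of_le_ncard e hk
  obtain ⟨a, haA, hva⟩ := he
  obtain ⟨a', ha', b', hb', hf⟩ := hf
  have hdisj := Set.disjoint_left.1 hAB
  have hge : ∀ i < k - 1, g i ≠ e := by
    rintro i hi rfl
    obtain ⟨b, hb, h⟩ := hgB i hi
    exact hdisj haA (h.right_unique hva ▸ hb)
  have hgf : ∀ i < k - 1, g i ≠ f := by
    rintro i hi rfl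
    obtain ⟨b, hb, h⟩ := hgB i hi
    obtain rfl | rfl := h.left_eq_or_eq hf
    · exact hvA ha'
    · exact hvB hb'
  have hef : e ≠ f := by
    rintro rfl
    obtain rfl | rfl := hva.left_eq_or_eq hf
    · exact hvA ha'
    · exact hvB hb'
  -- Edge `0` of the bond is the subdivided one, so the intact edges are `1, …, k - 1`; they are
  -- shifted by one to match `g`.
  have hE : ∀ d x y, (bondPlus k).IsLink d x y →
      (∃ i, d = .inl (i + 1) ∧ i < k - 1 ∧
        (x = some 0 ∧ y = some 1 ∨ x = some 1 ∧ y = some 0)) ∨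
      (d = .inr 0 ∧ (x = some 0 ∧ y = none ∨ x = none ∧ y = some 0)) ∨
      (d = .inr 1 ∧ (x = some 1 ∧ y = none ∨ x = none ∧ y = some 1)) := by
    rintro (d | d) x y h
    · obtain ⟨h0, a, b, hab, rfl, rfl⟩ := h
      simp only [bond, Graph.banana_isLink, Set.mem_ofPred_eq] at hab
      refine .inl ⟨d - 1, ?_, by omega, ?_⟩
      · rw [Nat.sub_add_cancel (by omega)]
      · simpa using hab.2
    · obtain ⟨⟨c, hc⟩, h⟩ := h
      simp only [bond, Graph.banana_isLink, Set.mem_ofPred_eq] at hc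
      obtain ⟨-, ⟨rfl, -⟩ | ⟨rfl, -⟩⟩ := hc <;> simp [h]
  let P : Option ℕ → Set α := fun o => match o with
    | none => A
    | some 0 => {v}
    | some _ => B
  let r : Option ℕ → α := fun o => match o with
    | none => a
    | some 0 => v
    | some _ => b'
  let j : ℕ ⊕ ℕ → β := fun d => match d with
    | .inl i => g (i - 1)
    | .inr 0 => e
    | .inr _ => f
  have hV : ∀ x ∈ V(bondPlus k), x = none ∨ x = some 0 ∨ x = some 1 := by
    rintro x (rfl | ⟨i, hi, rfl⟩)
    · simp
    · simpa [bond] using hi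
  refine hasMinor_of_model hfin (bondPlus_loopless k) P r j ?_ ?_ ?_ ?_ ?_ ?_
  · intro x hx
    obtain rfl | rfl | rfl := hV x hx
    · exact hAV
    · simpa [P] using hv
    · exact hBV
  · intro x hx
    obtain rfl | rfl | rfl := hV x hx
    · exact haA
    · exact rfl
    · exact hb'
  · intro x hx
    obtain rfl | rfl | rfl := hV x hx
    · exact hA
    · exact connectedOn_singleton G v
    · exact hB
  · intro x hx y hy u hux huy
    obtain rfl | rfl | rfl := hV x hx <;> obtain rfl | rfl | rfl := hV y hy <;>
      simp only [P, Set.mem_singleton_iff] at hux huy <;> grind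
  · intro d hd d' hd' hdd
    obtain ⟨x, y, h⟩ := Graph.exists_isLink_of_mem_edgeSet hd
    obtain ⟨x', y', h'⟩ := Graph.exists_isLink_of_mem_edgeSet hd'
    obtain ⟨i, rfl, hi, -⟩ | ⟨rfl, -⟩ | ⟨rfl, -⟩ := hE _ _ _ h <;>
    obtain ⟨i', rfl, hi', -⟩ | ⟨rfl, -⟩ | ⟨rfl, -⟩ := hE _ _ _ h' <;>
    simp only [j, Nat.add_sub_cancel] at hdd
    · rw [hg hi hi' hdd]
    · exact (hge _ hi hdd).elim
    · exact (hgf _ hi hdd).elim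
    · exact (hge _ hi' hdd.symm).elim
    · rfl
    · exact (hef hdd).elim
    · exact (hgf _ hi' hdd.symm).elim
    · exact (hef hdd.symm).elim
    · rfl
  · intro d x y h
    obtain ⟨i, rfl, hi, ⟨rfl, rfl⟩ | ⟨rfl, rfl⟩⟩ | ⟨rfl, ⟨rfl, rfl⟩ | ⟨rfl, rfl⟩⟩ |
      ⟨rfl, ⟨rfl, rfl⟩ | ⟨rfl, rfl⟩⟩ := hE _ _ _ h
    · obtain ⟨b, hb, h⟩ := hgB i hi
      exact ⟨v, rfl, b, hb, h⟩
    · obtain ⟨b, hb, h⟩ := hgB i hi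
      exact ⟨b, hb, v, rfl, h.symm⟩
    · exact ⟨v, rfl, a, haA, hva⟩
    · exact ⟨a, haA, v, rfl, hva.symm⟩
    · exact ⟨b', hb', a', ha', hf.symm⟩
    · exact ⟨a', ha', b', hb', hf⟩

/-- A vertex of large degree in a 2-connected graph with at least three vertices gives a minor
`B_k^+`. -/
lemma hasMinor_bondPlus_of_degree {G : Graph α β} (hfin : V(G).Finite) (hG : TwoConnected G)
    {k : ℕ} {v : α} (hv : v ∈ V(G)) (hV : (V(G) \ {v}).Nontrivial)
    (hk : 2 * k ≤ {e | G.Inc e v}.ncard) (hE : E(G).Finite) : HasMinor G (bondPlus k) := by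
  have := hG.loopless
  have hY := hG.connectedOn_sdiff hv
  obtain ⟨w, hw⟩ := hV.nonempty
  obtain ⟨v', a, hv', -, hva, -, ha⟩ := exists_adj_of_reflTransGen
    (hG.connected.connectedOn v hv w hw.1) (T := {v}) rfl hw.2
  obtain rfl : v' = v := hv'
  -- A third vertex `z` is still reachable when `a` is deleted, which forces a second neighbour `b`
  -- of the given vertex.
  obtain ⟨z, hz, hza⟩ := hV.exists_ne a
  obtain ⟨v'', b, hv'', -, hvb, -, hb⟩ := exists_adj_of_reflTransGen
    (hG.connectedOn_sdiff ha v' ⟨hv, hva.ne⟩ z ⟨hz.1, hza⟩) (T := {v'}) rfl hz.2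
  obtain rfl : v'' = v' := hv''
  obtain ⟨A, B, haA, hbB, hAB, hABY, hA, hB⟩ := hY.exists_partition (a := a) (b := b)
    ⟨ha, hva.ne.symm⟩ ⟨hb.1, hvb.ne.symm⟩ (fun h => hb.2 h.symm)
  have hAY : A ⊆ V(G) \ {v''} := hABY ▸ Set.subset_union_left
  have hBY : B ⊆ V(G) \ {v''} := hABY ▸ Set.subset_union_right
  obtain ⟨a', b', ha', hb', ⟨f, hf⟩, -, hb''⟩ :=
    exists_adj_of_reflTransGen (hY a (hAY haA) b (hBY hbB)) haA
    (fun h => Set.disjoint_left.1 hAB h hbB)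
  replace hb' : b' ∈ B := by
    rw [← hABY] at hb''
    exact hb''.resolve_left hb'
  obtain ⟨ea, hea⟩ := hva
  obtain ⟨eb, heb⟩ := hvb
  have hle : {e | G.Inc e v''}.ncard ≤ {d | ∃ a ∈ A, G.IsLink d v'' a}.ncard +
      {d | ∃ b ∈ B, G.IsLink d v'' b}.ncard := by
    refine (Set.ncard_le_ncard ?_ ?_).trans (Set.ncard_union_le _ _)
    · rintro e ⟨u, hu⟩
      have huY : u ∈ V(G) \ {v''} := ⟨hu.right_mem, hu.ne.symm⟩
      rw [← hABY] at huY
      exact huY.imp (fun h => ⟨u, h, hu⟩) (fun h => ⟨u, h, hu⟩)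
    · refine hE.subset ?_
      rintro e (⟨u, -, h⟩ | ⟨u, -, h⟩) <;> exact h.edge_mem
  -- The part receiving more edges plays the role of `B`, the other is the subdividing vertex.
  rcases le_total {d | ∃ a ∈ A, G.IsLink d v'' a}.ncard {d | ∃ b ∈ B, G.IsLink d v'' b}.ncard with h | h
  · exact hasMinor_bondPlus_of_parts hfin hv (fun x hx => (hAY hx).1) (fun x hx => (hBY hx).1)
      (fun h => (hAY h).2 rfl) (fun h => (hBY h).2 rfl) hAB hA hB ⟨a, haA, hea⟩
      ⟨a', ha', b', hb', hf⟩ (by omega)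
  · exact hasMinor_bondPlus_of_parts hfin hv (fun x hx => (hBY hx).1) (fun x hx => (hAY hx).1)
      (fun h => (hBY h).2 rfl) (fun h => (hAY h).2 rfl) hAB.symm hB hA ⟨b, hbB, heb⟩
      ⟨b', hb', a', ha', hf.symm⟩ (by omega)

/-! ### Two internally disjoint paths. -/

/-- The simple graph underlying a multigraph. -/
def toSimple (G : Graph α β) : SimpleGraph α where
  Adj x y := x ≠ y ∧ G.Adj x y
  symm := ⟨fun _ _ h => ⟨h.1.symm, h.2.symm⟩⟩
  loopless := ⟨fun _ h => h.1 rfl⟩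

lemma exists_walk_of_reflTransGen {G : Graph α β} {S : Set α} {a b : α} (hb : b ∈ S)
    (h : ReflTransGen (AdjIn G S) a b) : ∃ p : (toSimple G).Walk a b, ∀ x ∈ p.support, x ∈ S := by
  induction h using ReflTransGen.head_induction_on with
  | refl => exact ⟨.nil, by simpa using hb⟩
  | @head a c hac _ ih =>
    obtain ⟨p, hp⟩ := ih
    by_cases h : a = c
    · subst h
      exact ⟨p, hp⟩
    · have hadj : (toSimple G).Adj a c := ⟨h, hac.1⟩
      exact ⟨.cons hadj p, fun x hx => by
        rw [SimpleGraph.Walk.support_cons, List.mem_cons] at hx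
        exact hx.elim (fun h => h ▸ hac.2.1) (hp x)⟩

-- Inductive step from `c` to its neighbour `b`: `R` runs from `b` to its first vertex `z` on `P ∪
-- Q`, here on `P`. One new path follows `P` to `z` and then `R` back to `b`; the other is `Q`
-- followed by the edge `cb`.
open Classical in
lemma exists_disjoint_paths_step {V : Type*} {H : SimpleGraph V} {a b c z : V} (P Q : H.Walk a c)
    (hP : P.IsPath) (hQ : Q.IsPath) (hPQ : ∀ x ∈ P.support, x ∈ Q.support → x = a ∨ x = c)
    (hcb : H.Adj c b) (hba : b ≠ a) (hz : z ∈ P.support) (hzc : z ≠ c) (R : H.Walk b z)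
    (hR : R.IsPath) (hRP : ∀ x ∈ R.support, x ∈ P.support → x = z)
    (hRQ : ∀ x ∈ R.support, x ∈ Q.support → x = z) :
    ∃ P Q : H.Walk a b, P.IsPath ∧ Q.IsPath ∧
      ∀ x ∈ P.support, x ∈ Q.support → x = a ∨ x = b := by
  have hbQ : b ∉ Q.support := by
    intro h
    obtain rfl := hRQ b R.start_mem_support h
    exact (hPQ _ hz h).elim hba hzc
  refine ⟨(P.takeUntil z hz).append R.reverse, Q.concat hcb, ?_, hQ.concat hbQ hcb, ?_⟩
  · rw [SimpleGraph.Walk.isPath_def, SimpleGraph.Walk.support_append]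
    have hn := hR.reverse.support_nodup
    rw [← SimpleGraph.Walk.cons_tail_support, List.nodup_cons] at hn
    refine List.nodup_append.2 ⟨(hP.takeUntil hz).support_nodup, hn.2, ?_⟩
    rintro x hx y hy rfl
    have hxR : x ∈ R.support := by
      have := List.mem_of_mem_tail hy
      simpa using this
    obtain rfl := hRP x hxR (P.support_takeUntil_subset_support hz hx)
    exact hn.1 hy
  · intro x hx hxQ
    rw [SimpleGraph.Walk.support_concat] at hxQ
    simp only [List.mem_append, List.mem_singleton] at hxQ
    rcases hxQ with hxQ | rfl
    · rw [SimpleGraph.Walk.mem_support_append_iff] at hx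
      rcases hx with hx | hx
      · refine .inl ((hPQ x (P.support_takeUntil_subset_support hz hx) hxQ).resolve_right ?_)
        rintro rfl
        exact SimpleGraph.Walk.endpoint_notMem_support_takeUntil hP hz hzc.symm hx
      · obtain rfl := hRQ x (by simpa using hx) hxQ
        exact .inl ((hPQ x hz hxQ).resolve_right hzc)
    · exact .inr rfl

open Classical in
/-- Any two vertices of a 2-connected graph are joined by two internally disjoint paths. -/
lemma TwoConnected.exists_disjoint_paths {G : Graph α β} (hG : TwoConnected G) {a b : α}
    (ha : a ∈ V(G)) (hb : b ∈ V(G)) (hab : b ≠ a) :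
    ∃ P Q : (toSimple G).Walk a b, P.IsPath ∧ Q.IsPath ∧
      ∀ x ∈ P.support, x ∈ Q.support → x = a ∨ x = b := by
  have := hG.loopless
  have h := hG.connected.connectedOn a ha b hb
  induction h with
  | refl => exact (hab rfl).elim
  | @tail c b hac hcb ih =>
    have hcb' : (toSimple G).Adj c b := ⟨hcb.1.ne, hcb.1⟩
    -- When `c = a`, the edge `ab` serves as both paths, as the statement permits `P = Q`.
    by_cases hca : c = a
    · subst hca
      have hp : (SimpleGraph.Walk.cons hcb' .nil).IsPath := by simp [hab.symm]
      exact ⟨.cons hcb' .nil, .cons hcb' .nil, hp, hp, fun x hx _ => by simpa using hx⟩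
    · obtain ⟨P, Q, hP, hQ, hPQ⟩ := ih hcb.2.1 hca
      obtain ⟨R, hR⟩ := exists_walk_of_reflTransGen (S := V(G) \ {c}) (b := a)
        ⟨ha, fun h => hca h.symm⟩
        (hG.connectedOn_sdiff hcb.2.1 b ⟨hb, hcb.1.ne.symm⟩ a ⟨ha, fun h => hca h.symm⟩)
      -- `R` avoids `c`, so its first vertex `z` on `P ∪ Q` differs from `c`.
      obtain ⟨z, hz, hzR, hz'⟩ := R.bypass.exists_mem_support_forall_mem_support_imp_eq
        (P.support.toFinset ∪ Q.support.toFinset) ⟨a, by simp⟩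
      have hzc : z ≠ c := (hR z (R.support_bypass_subset_support hzR)).2
      have hR' := R.bypass_isPath.takeUntil hzR
      rw [Finset.mem_union, List.mem_toFinset, List.mem_toFinset] at hz
      simp only [Finset.mem_union, List.mem_toFinset] at hz'
      rcases hz with hz | hz
      · exact exists_disjoint_paths_step P Q hP hQ hPQ hcb' hab hz hzc _ hR'
          (fun x hx hxP => hz' x (.inl hxP) hx) (fun x hx hxQ => hz' x (.inr hxQ) hx)
      · exact exists_disjoint_paths_step Q P hQ hP (fun x hx hx' => hPQ x hx' hx) hcb' hab hz hzc
          _ hR' (fun x hx hxP => hz' x (.inr hxP) hx) (fun x hx hxQ => hz' x (.inl hxQ) hx)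

/-! ### Long cycles in large graphs of bounded degree. -/

/-- The closed walk of length `L` through the vertices `c i` and the edges `e i` is a cycle
with at least three edges. -/
structure IsCycleSeq (G : Graph α β) (L : ℕ) (c : ℕ → α) (e : ℕ → β) : Prop where
  three_le : 3 ≤ L
  injOn : Set.InjOn c {i | i < L}
  closed : c L = c 0
  isLink : ∀ i < L, G.IsLink (e i) (c i) (c (i + 1))

lemma exists_isCycleSeq_of_disjoint_paths {G : Graph α β} [Nonempty β] {a b : α}
    (P Q : (toSimple G).Walk a b)
    (hP : P.IsPath) (hQ : Q.IsPath) (hPQ : ∀ x ∈ P.support, x ∈ Q.support → x = a ∨ x = b)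
    (hp : 2 ≤ P.length) (hq : 2 ≤ Q.length) :
    ∃ c e, IsCycleSeq G (P.length + Q.length) c e := by
  set p := P.length
  set q := Q.length
  -- The cycle runs along `P` from `a` to `b` and returns along `Q`.
  set c : ℕ → α := fun i => if i ≤ p then P.getVert i else Q.getVert (p + q - i) with hc
  have hc1 : ∀ i ≤ p, c i = P.getVert i := fun i hi => by simp [hc, hi]
  have hc2 : ∀ i, p ≤ i → c i = Q.getVert (p + q - i) := fun i hi => by
    rcases hi.eq_or_lt with rfl | hi
    · rw [hc1 _ le_rfl, Nat.add_sub_cancel_left, P.getVert_length, Q.getVert_length]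
    · simp [hc, hi.not_ge]
  have hadj : ∀ i < p + q, G.Adj (c i) (c (i + 1)) := by
    intro i hi
    rcases lt_or_ge i p with h | h
    · rw [hc1 i h.le, hc1 (i + 1) h]
      exact (P.adj_getVert_succ h).2
    · rw [hc2 i h, hc2 (i + 1) (by omega), show p + q - i = p + q - (i + 1) + 1 by omega]
      exact (Q.adj_getVert_succ (by omega)).2.symm
  choose! e he using hadj
  have hmix : ∀ i j, i ≤ p → p < j → j < p + q → c i ≠ c j := by
    intro i j hi hj hjq h
    rw [hc1 i hi, hc2 j hj.le] at h
    have h1 : Q.getVert (p + q - j) ∈ P.support := h ▸ P.getVert_mem_support i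
    rcases hPQ _ h1 (Q.getVert_mem_support _) with h2 | h2
    · have := hQ.getVert_injOn (show p + q - j ≤ q by omega) (Nat.zero_le q)
        (h2.trans Q.getVert_zero.symm)
      omega
    · have := hQ.getVert_injOn (show p + q - j ≤ q by omega) (le_refl q)
        (h2.trans Q.getVert_length.symm)
      omega
  refine ⟨c, e, ⟨by omega, ?_, ?_, he⟩⟩
  · intro i hi j hj hij
    replace hi : i < p + q := hi
    replace hj : j < p + q := hj
    rcases le_or_gt i p with h | h <;> rcases le_or_gt j p with h' | h'
    · rw [hc1 i h, hc1 j h'] at hij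
      exact hP.getVert_injOn h h' hij
    · exact (hmix i j h h' hj hij).elim
    · exact (hmix j i h' h hi hij.symm).elim
    · rw [hc2 i h.le, hc2 j h'.le] at hij
      have := hQ.getVert_injOn (show p + q - i ≤ q by omega) (show p + q - j ≤ q by omega) hij
      omega
  · rw [hc1 0 (Nat.zero_le _), hc2 _ (by omega), Nat.sub_self, P.getVert_zero, Q.getVert_zero]

lemma ncard_biUnion_le_mul {γ : Type*} {S : Set α} (hS : S.Finite) (f : α → Set γ) (d : ℕ)
    (h : ∀ u ∈ S, (f u).ncard ≤ d) : (⋃ u ∈ S, f u).ncard ≤ S.ncard * d := by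
  induction S, hS using Set.Finite.induction_on with
  | empty => simp
  | @insert a S ha hS ih =>
    rw [Set.biUnion_insert, Set.ncard_insert_of_notMem ha hS, add_mul, one_mul, add_comm]
    exact (Set.ncard_union_le _ _).trans
      (add_le_add (h a (by simp)) (ih fun u hu => h u (by simp [hu])))

/-- The vertices at distance at most `n` from `a`. -/
def ball (G : Graph α β) (a : α) : ℕ → Set α
  | 0 => {a}
  | n + 1 => ball G a n ∪ ⋃ u ∈ ball G a n, {w | G.Adj u w}

lemma ball_subset {G : Graph α β} {a : α} (ha : a ∈ V(G)) (n : ℕ) : ball G a n ⊆ V(G) := by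
  induction n with
  | zero => simpa [ball] using ha
  | succ n ih =>
    refine Set.union_subset ih (Set.iUnion₂_subset fun u _ w hw => hw.right_mem)

/-- A vertex has at most as many neighbours as incident edges, so each increase of the radius
multiplies the size by at most `1 + d`. -/
lemma ncard_ball_le {G : Graph α β} (hfin : V(G).Finite) (hE : E(G).Finite) {d : ℕ}
    (hd : ∀ v ∈ V(G), {e | G.Inc e v}.ncard ≤ d) {a : α} (ha : a ∈ V(G)) (n : ℕ) :
    (ball G a n).ncard ≤ (1 + d) ^ n := by
  induction n with
  | zero => simp [ball]
  | succ n ih =>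
    have hN : ∀ u ∈ ball G a n, {w | G.Adj u w}.ncard ≤ d := by
      intro u hu
      refine le_trans ?_ (hd u (ball_subset ha n hu))
      have hex : ∀ e, ∃ w, G.Inc e u → G.IsLink e u w := fun e => by
        by_cases h : G.Inc e u
        · exact h.imp fun w hw _ => hw
        · exact ⟨u, fun h' => (h h').elim⟩
      choose o ho using hex
      refine (Set.ncard_le_ncard ?_ ((hE.subset fun e he => he.edge_mem).image o)).trans
        (Set.ncard_image_le (hE.subset fun e he => he.edge_mem))
      rintro w ⟨e, he⟩
      exact ⟨e, ⟨w, he⟩, (ho e ⟨w, he⟩).right_unique he⟩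
    refine (Set.ncard_union_le _ _).trans ?_
    have := ncard_biUnion_le_mul (hfin.subset (ball_subset ha n)) _ d hN
    calc _ ≤ (ball G a n).ncard + (ball G a n).ncard * d := by gcongr
      _ = (ball G a n).ncard * (1 + d) := by ring
      _ ≤ _ := by rw [pow_succ]; gcongr

lemma mem_ball_of_walk {G : Graph α β} {a u w : α} (p : (toSimple G).Walk u w) {n : ℕ}
    (hu : u ∈ ball G a n) : w ∈ ball G a (n + p.length) := by
  induction p generalizing n with
  | nil => simpa using hu
  | @cons u v w h p ih =>
    have := ih (n := n + 1) (.inr (Set.mem_iUnion₂.2 ⟨u, hu, h.2⟩))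
    rwa [SimpleGraph.Walk.length_cons, add_comm p.length, ← add_assoc]

/-- If the ball were everything, there would be at most `(1 + d) ^ D` vertices, each on at most `d`
edges: too few edges. -/
lemma exists_notMem_ball {G : Graph α β} (hfin : V(G).Finite) (hE : E(G).Finite) {d D : ℕ}
    (hd : ∀ v ∈ V(G), {e | G.Inc e v}.ncard ≤ d) (h : (1 + d) ^ D * d < E(G).ncard) {a : α}
    (ha : a ∈ V(G)) : ∃ b ∈ V(G), b ∉ ball G a D := by
  by_contra! hcon
  have h1 : V(G).ncard ≤ (1 + d) ^ D :=
    (Set.ncard_le_ncard hcon (hfin.subset (ball_subset ha D))).trans (ncard_ball_le hfin hE hd ha D)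
  have h2 := ncard_biUnion_le_mul hfin (fun v => {e | G.Inc e v}) d hd
  have h3 : E(G) ⊆ ⋃ v ∈ V(G), {e | G.Inc e v} := by
    intro e he
    obtain ⟨x, y, h⟩ := Graph.exists_isLink_of_mem_edgeSet he
    exact Set.mem_iUnion₂.2 ⟨x, h.left_mem, y, h⟩
  have h4 := Set.ncard_le_ncard h3 (hE.subset (Set.iUnion₂_subset fun v _ e he => he.edge_mem))
  have h5 := Nat.mul_le_mul_right d h1
  omega

/-- A large 2-connected graph of bounded degree has a long cycle. -/
lemma TwoConnected.exists_long_isCycleSeq {G : Graph α β} (hG : TwoConnected G)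
    (hfin : V(G).Finite) (hE : E(G).Finite) {d D : ℕ} (hD : 1 ≤ D)
    (hd : ∀ v ∈ V(G), {e | G.Inc e v}.ncard ≤ d) (h : (1 + d) ^ D * d < E(G).ncard) :
    ∃ L c e, D ≤ L ∧ IsCycleSeq G L c e := by
  obtain ⟨a, ha⟩ := hG.connected.1
  obtain ⟨b, hb, hbD⟩ := exists_notMem_ball hfin hE hd h ha
  -- As `1 ≤ D`, both disjoint paths have length at least two, which excludes the degenerate case of
  -- one edge used twice.
  have hlen : ∀ p : (toSimple G).Walk a b, D < p.length := by
    intro p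
    by_contra! hp
    have hmono : Monotone (ball G a) := monotone_nat_of_le_succ fun n => Set.subset_union_left
    have := mem_ball_of_walk (a := a) p (n := 0) rfl
    rw [zero_add] at this
    exact hbD (hmono hp this)
  have hba : b ≠ a := by
    rintro rfl
    have := hlen .nil
    simp at this
  obtain ⟨e₀, -⟩ := (Set.ncard_pos hE).1 (by omega : 0 < E(G).ncard)
  have : Nonempty β := ⟨e₀⟩
  obtain ⟨P, Q, hP, hQ, hPQ⟩ := hG.exists_disjoint_paths ha hb hba
  have hp := hlen P
  have hq := hlen Q
  obtain ⟨c, e, hce⟩ := exists_isCycleSeq_of_disjoint_paths P Q hP hQ hPQ (by omega) (by omega)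
  exact ⟨_, c, e, by omega, hce⟩

/-! ### Reindexing a cycle. -/

namespace IsCycleSeq

variable {G : Graph α β} {L : ℕ} {c : ℕ → α} {e : ℕ → β}

lemma eq_of_eq (h : IsCycleSeq G L c e) {i j : ℕ} (hi : i < L) (hj : j < L) (hij : c i = c j) :
    i = j := h.injOn hi hj hij

lemma apply_succ (h : IsCycleSeq G L c e) {i : ℕ} (hi : i < L) : c (i + 1) = c ((i + 1) % L) := by
  rcases Nat.lt_or_ge (i + 1) L with h1 | h1
  · rw [Nat.mod_eq_of_lt h1]
  · obtain rfl : i + 1 = L := by omega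
    rw [Nat.mod_self, h.closed]

lemma mem_vertexSet (h : IsCycleSeq G L c e) {i : ℕ} (hi : i < L) : c i ∈ V(G) :=
  (h.isLink i hi).left_mem

lemma succ_mod_cases {L i : ℕ} (hi : i < L) :
    (i + 1 < L ∧ (i + 1) % L = i + 1) ∨ (i + 1 = L ∧ (i + 1) % L = 0) := by
  rcases Nat.lt_or_ge (i + 1) L with h1 | h1
  · exact .inl ⟨h1, Nat.mod_eq_of_lt h1⟩
  · obtain rfl : i + 1 = L := by omega
    exact .inr ⟨rfl, Nat.mod_self _⟩

/-- An edge used at two places `i ≠ j` would be traversed in opposite directions, so `i ≡ j + 1` and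
`j ≡ i + 1` modulo `L`, against `3 ≤ L`. -/
lemma injOn_edges (h : IsCycleSeq G L c e) {i j : ℕ} (hi : i < L) (hj : j < L) (hij : e i = e j) :
    i = j := by
  have h1 := h.isLink i hi
  have h2 := h.isLink j hj
  rw [hij] at h1
  rw [h.apply_succ hi] at h1
  rw [h.apply_succ hj] at h2
  have h3 := h.three_le
  obtain ⟨h4, -⟩ | ⟨h4, h5⟩ := h1.eq_and_eq_or_eq_and_eq h2
  · exact h.eq_of_eq hi hj h4
  · have h4 := h.eq_of_eq hi (Nat.mod_lt _ (by omega)) h4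
    have h5 := h.eq_of_eq (Nat.mod_lt _ (by omega)) hj h5
    have h6 := succ_mod_cases hi
    have h7 := succ_mod_cases hj
    omega

lemma reverse (h : IsCycleSeq G L c e) :
    IsCycleSeq G L (fun i => c (L - i)) (fun i => e (L - 1 - i)) := by
  refine ⟨h.three_le, fun i hi j hj hij => ?_, ?_, fun i hi => ?_⟩
  · replace hi : i < L := hi
    replace hj : j < L := hj
    -- At `i = 0` the index `L` lies outside the range of injectivity and must be replaced by `0`.
    have h0 : ∀ i < L, c (L - i) = c ((L - i) % L) := fun i hi => by
      rcases Nat.eq_zero_or_pos i with rfl | h0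
      · rw [Nat.sub_zero, Nat.mod_self, h.closed]
      · rw [Nat.mod_eq_of_lt (by omega)]
    have h1 : ∀ i < L, (i = 0 ∧ (L - i) % L = 0) ∨ (0 < i ∧ (L - i) % L = L - i) := fun i hi => by
      rcases Nat.eq_zero_or_pos i with rfl | h0
      · exact .inl ⟨rfl, by simp⟩
      · exact .inr ⟨h0, Nat.mod_eq_of_lt (by omega)⟩
    rw [h0 i hi, h0 j hj] at hij
    have := h.eq_of_eq (Nat.mod_lt _ (by omega)) (Nat.mod_lt _ (by omega)) hij
    have := h1 i hi
    have := h1 j hj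
    omega
  · simp [h.closed]
  · have := (h.isLink (L - 1 - i) (by omega)).symm
    rw [show L - 1 - i + 1 = L - i by omega] at this
    rwa [show L - (i + 1) = L - 1 - i by omega]

lemma rotate (h : IsCycleSeq G L c e) (s : ℕ) :
    IsCycleSeq G L (fun i => c ((i + s) % L)) (fun i => e ((i + s) % L)) := by
  have hL : 0 < L := by have := h.three_le; omega
  refine ⟨h.three_le, fun i hi j hj hij => ?_, ?_, fun i hi => ?_⟩
  · have h1 : i + s ≡ j + s [MOD L] := h.eq_of_eq (Nat.mod_lt _ hL) (Nat.mod_lt _ hL) hij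
    exact Nat.ModEq.eq_of_lt_of_lt (Nat.ModEq.add_right_cancel' s h1) hi hj
  · simp
  · have h1 := h.isLink _ (Nat.mod_lt (i + s) hL)
    rw [h.apply_succ (Nat.mod_lt _ hL)] at h1
    have h2 : ((i + s) % L + 1) % L = (i + 1 + s) % L := by
      rw [Nat.mod_add_mod]
      congr 1
      omega
    rwa [h2] at h1

lemma connectedOn_image (h : IsCycleSeq G L c e) {I : Set ℕ} (hI : I.OrdConnected)
    (hIL : ∀ i ∈ I, i < L) : ConnectedOn G (c '' I) := by
  have key : ∀ i ∈ I, ∀ j ∈ I, i ≤ j → ReflTransGen (AdjIn G (c '' I)) (c i) (c j) := by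
    intro i hi j hj hij
    induction j, hij using Nat.le_induction with
    | base => exact .refl
    | succ j hij ih =>
      have hj' : j ∈ I := hI.out hi hj ⟨hij, j.le_succ⟩
      exact (ih hj').tail ⟨⟨_, h.isLink j (hIL j hj')⟩, ⟨j, hj', rfl⟩, ⟨_, hj, rfl⟩⟩
  rintro _ ⟨i, hi, rfl⟩ _ ⟨j, hj, rfl⟩
  rcases le_total i j with hij | hij
  · exact key i hi j hj hij
  · exact reflTransGen_adjIn_symm (key j hj i hi hij)

end IsCycleSeq

/-! ### The minor `C_k^+` from a long cycle and an ear. -/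

lemma cyclePlus_loopless {k : ℕ} (hk : 2 ≤ k) : (cyclePlus k).Loopless := by
  refine ⟨fun d x h => ?_⟩
  obtain ⟨hi, h⟩ : d.getD 0 < k ∧ ((x = d.getD 0 ∧ x = (d.getD 0 + 1) % k) ∨
    (x = (d.getD 0 + 1) % k ∧ x = d.getD 0)) := h
  have := IsCycleSeq.succ_mod_cases hi
  omega

/-- The set `A` becomes vertex `0` and the stretch `c 1, …, c j` goes into vertex `1`, so `f`
becomes parallel to `e 0`. The rest of the cycle still supplies the other vertices because `k - 1 +
j ≤ L`. -/
lemma IsCycleSeq.hasMinor_cyclePlus_of_chord {G : Graph α β} {L : ℕ} {c : ℕ → α} {e : ℕ → β}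
    (h : IsCycleSeq G L c e) (hfin : V(G).Finite) {A : Set α} (hA : ConnectedOn G A)
    (hAV : A ⊆ V(G)) (h0 : c 0 ∈ A) (hAc : ∀ i, 0 < i → i < L → c i ∉ A) {f : β} {j : ℕ}
    (hj : 0 < j) (hf : ∃ a ∈ A, G.IsLink f a (c j)) (hfe : ∀ i < L, f ≠ e i)
    {k : ℕ} (hk : 2 ≤ k) (hkL : k - 1 + j ≤ L) : HasMinor G (cyclePlus k) := by
  obtain ⟨a, ha, hf⟩ := hf
  have hL := h.three_le
  -- Truncated subtraction puts all `i ≤ j` in class `1`; the minimum puts the whole tail of the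
  -- cycle in class `k - 1`.
  let I : ℕ → Set ℕ := fun x => {i | 0 < i ∧ i < L ∧ min (k - 1) (i - j + 1) = x}
  let B : ℕ → Set α := fun x => if x = 0 then A else c '' I x
  let r : ℕ → α := fun x => if x = 0 then c 0 else c (j + x - 1)
  let t : ℕ → ℕ := fun i => if i = 0 then 0 else if i = k - 1 then L - 1 else i + j - 1
  let g : Option ℕ → β := fun d => d.elim f (fun i => e (t i))
  have hB0 : B 0 = A := if_pos rfl
  have hB : ∀ x, x ≠ 0 → B x = c '' I x := fun x hx => if_neg hx
  have ht : ∀ i < k, t i < L := by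
    intro i hi
    simp only [t]
    split_ifs <;> omega
  have hmem : ∀ x i, 0 < i → i < L → min (k - 1) (i - j + 1) = x → c i ∈ B x := by
    intro x i hi hiL hx
    rw [hB x (by omega)]
    exact ⟨i, ⟨hi, hiL, hx⟩, rfl⟩
  have hlink : ∀ d x y, (cyclePlus k).IsLink d x y → d.getD 0 < k ∧
      ((x = d.getD 0 ∧ y = (d.getD 0 + 1) % k) ∨ (x = (d.getD 0 + 1) % k ∧ y = d.getD 0)) :=
    fun d x y h => h
  have hmain : ∀ d : Option ℕ, d.getD 0 < k →
      ∃ u ∈ B (d.getD 0), ∃ v ∈ B ((d.getD 0 + 1) % k), G.IsLink (g d) u v := by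
    rintro (_ | i) hd
    · refine ⟨a, by simpa [hB0] using ha, c j, ?_, hf⟩
      simp only [Option.getD_none, zero_add]
      rw [Nat.mod_eq_of_lt (by omega)]
      exact hmem _ _ hj (by omega) (by omega)
    · simp only [Option.getD_some] at hd ⊢
      refine ⟨c (t i), ?_, c (t i + 1), ?_, h.isLink _ (ht i hd)⟩
      · rcases Nat.eq_zero_or_pos i with rfl | hi
        · simpa [t, hB0] using h0
        · refine hmem _ _ ?_ (ht i hd) ?_ <;> simp only [t] <;> split_ifs <;> omega
      · by_cases hik : i = k - 1
        · have : t i + 1 = L := by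
            simp only [t]
            split_ifs <;> omega
          rw [this, h.closed, hik, Nat.sub_add_cancel (by omega), Nat.mod_self, hB0]
          exact h0
        · rw [Nat.mod_eq_of_lt (by omega)]
          refine hmem _ _ (by omega) ?_ ?_ <;> simp only [t] <;> split_ifs <;> omega
  refine hasMinor_of_model hfin (cyclePlus_loopless hk) B r g ?_ ?_ ?_ ?_ ?_ ?_
  · intro x _
    rcases eq_or_ne x 0 with rfl | hx
    · rwa [hB0]
    · rw [hB x hx]
      rintro _ ⟨i, hi, rfl⟩
      exact h.mem_vertexSet hi.2.1
  · intro x hx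
    replace hx : x < k := hx
    rcases eq_or_ne x 0 with rfl | hx
    · simpa [hB0, r] using h0
    · simp only [r, if_neg hx]
      exact hmem _ _ (by omega) (by omega) (by omega)
  · intro x _
    rcases eq_or_ne x 0 with rfl | hx
    · rwa [hB0]
    · rw [hB x hx]
      refine h.connectedOn_image ⟨fun i hi l hl m hm => ?_⟩ fun i hi => hi.2.1
      obtain ⟨h1, h2, h3⟩ := hi
      obtain ⟨h4, h5, h6⟩ := hl
      obtain ⟨h7, h8⟩ := hm
      exact ⟨by omega, by omega, by omega⟩
  · intro x _ y _ v hvx hvy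
    rcases eq_or_ne x 0 with rfl | hx <;> rcases eq_or_ne y 0 with rfl | hy
    · rfl
    · rw [hB y hy] at hvy
      rw [hB0] at hvx
      obtain ⟨i, hi, rfl⟩ := hvy
      exact (hAc i hi.1 hi.2.1 hvx).elim
    · rw [hB x hx] at hvx
      rw [hB0] at hvy
      obtain ⟨i, hi, rfl⟩ := hvx
      exact (hAc i hi.1 hi.2.1 hvy).elim
    · rw [hB x hx] at hvx
      rw [hB y hy] at hvy
      obtain ⟨i, hi, rfl⟩ := hvx
      obtain ⟨l, hl, hil⟩ := hvy
      obtain rfl := h.eq_of_eq hl.2.1 hi.2.1 hil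
      exact hi.2.2.symm.trans hl.2.2
  · intro d hd d' hd' hdd
    obtain ⟨x, y, hx⟩ := Graph.exists_isLink_of_mem_edgeSet hd
    obtain ⟨x', y', hx'⟩ := Graph.exists_isLink_of_mem_edgeSet hd'
    have hd := (hlink _ _ _ hx).1
    have hd' := (hlink _ _ _ hx').1
    rcases d with _ | i <;> rcases d' with _ | i'
    · rfl
    · exact (hfe _ (ht i' hd') hdd).elim
    · exact (hfe _ (ht i hd) hdd.symm).elim
    · have h1 : t i = t i' := h.injOn_edges (ht i hd) (ht i' hd') hdd
      simp only [Option.getD_some] at hd hd'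
      simp only [t] at h1
      congr 1
      split_ifs at h1 <;> omega
  · intro d x y hd
    obtain ⟨h1, ⟨rfl, rfl⟩ | ⟨rfl, rfl⟩⟩ := hlink d x y hd
    · exact hmain d h1
    · obtain ⟨u, hu, v, hv, huv⟩ := hmain d h1
      exact ⟨v, hv, u, hu, huv.symm⟩

/-- A long cycle together with an ear whose interior may be contracted to a vertex of the cycle
gives a minor `C_k^+`. -/
lemma IsCycleSeq.hasMinor_cyclePlus_of_ear {G : Graph α β} {L : ℕ} {c : ℕ → α} {e : ℕ → β}
    (h : IsCycleSeq G L c e) (hfin : V(G).Finite) {A : Set α} (hA : ConnectedOn G A)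
    (hAV : A ⊆ V(G)) {s t : ℕ} (hs : s < L) (ht : t < L) (hst : s ≠ t) (hsA : c s ∈ A)
    (hAc : ∀ i < L, c i ∈ A → i = s) {f : β}
    (hf : ∃ a ∈ A, G.IsLink f a (c t)) (hfe : ∀ i < L, f ≠ e i)
    {k : ℕ} (hk : 2 ≤ k) (hkL : 2 * k ≤ L) : HasMinor G (cyclePlus k) := by
  have hL : 0 < L := by omega
  have hr := h.rotate s
  obtain ⟨j, hj0, hjL, hjt⟩ : ∃ j, 0 < j ∧ j < L ∧ (j + s) % L = t := by
    rcases Nat.lt_or_gt_of_ne hst with h1 | h1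
    · exact ⟨t - s, by omega, by omega, by rw [Nat.sub_add_cancel h1.le, Nat.mod_eq_of_lt ht]⟩
    · refine ⟨L + t - s, by omega, by omega, ?_⟩
      rw [Nat.sub_add_cancel (by omega), Nat.add_mod_left, Nat.mod_eq_of_lt ht]
  have h0 : c ((0 + s) % L) ∈ A := by rwa [zero_add, Nat.mod_eq_of_lt hs]
  have hAc' : ∀ i, 0 < i → i < L → c ((i + s) % L) ∉ A := by
    intro i hi hiL hiA
    have h1 : i + s ≡ 0 + s [MOD L] := by
      rw [Nat.ModEq, hAc _ (Nat.mod_lt _ hL) hiA, zero_add, Nat.mod_eq_of_lt hs]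
    have := Nat.ModEq.eq_of_lt_of_lt (Nat.ModEq.add_right_cancel' s h1) hiL hL
    omega
  rw [← hjt] at hf
  -- If too little of the cycle lies beyond `j`, reversing it replaces `j` by `L - j`, which is
  -- small enough since `2 * k ≤ L`.
  rcases Nat.lt_or_ge L (k - 1 + j) with h1 | h1
  · refine hr.reverse.hasMinor_cyclePlus_of_chord hfin hA hAV ?_ ?_ (j := L - j) (by omega) ?_
      (fun i hi => hfe _ (Nat.mod_lt _ hL)) hk (by omega)
    · simpa [Nat.mod_eq_of_lt hs] using hsA
    · exact fun i hi hiL => hAc' _ (by omega) (by omega)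
    · rwa [Nat.sub_sub_self hjL.le]
  · exact hr.hasMinor_cyclePlus_of_chord hfin hA hAV h0 hAc' hj0 hf
      (fun i hi => hfe _ (Nat.mod_lt _ hL)) hk h1

/-- A 2-connected graph with a long cycle that does not contain all edges has a minor `C_k^+`. -/
lemma IsCycleSeq.hasMinor_cyclePlus {G : Graph α β} {L : ℕ} {c : ℕ → α} {e : ℕ → β}
    (h : IsCycleSeq G L c e) (hfin : V(G).Finite) (hG : TwoConnected G)
    {k : ℕ} (hk : 2 ≤ k) (hkL : 2 * k ≤ L) {f : β} (hf : f ∈ E(G)) (hfe : ∀ i < L, f ≠ e i) :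
    HasMinor G (cyclePlus k) := by
  have := hG.loopless
  have hL : 0 < L := by omega
  set C : Set α := c '' {i | i < L} with hC
  by_cases hCV : ∃ z ∈ V(G), z ∉ C
  · obtain ⟨z, hz, hzC⟩ := hCV
    -- `Z` is the component of `z` off the cycle. It is attached to some `c s` and, as `c s` is not
    -- a cut vertex, also to another `c t`; `{c s} ∪ Z` is then the set to contract.
    set Z := reachSet G (V(G) \ C) z
    have hZ : Z ⊆ V(G) \ C := reachSet_subset ⟨hz, hzC⟩
    have hout : ∀ u w, u ∈ Z → w ∉ Z → G.Adj u w → w ∈ C := by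
      intro u w hu hw huw
      by_contra hwC
      exact hw (ReflTransGen.tail hu ⟨huw, hZ hu, huw.right_mem, hwC⟩)
    have hCZ : ∀ i < L, c i ∉ Z := fun i hi hiZ => (hZ hiZ).2 ⟨i, hi, rfl⟩
    obtain ⟨u, w, hu, hw, huw, -⟩ := exists_adj_of_reflTransGen
      (hG.connected.connectedOn z hz _ (h.mem_vertexSet hL)) (T := Z) .refl (hCZ 0 hL)
    obtain ⟨s, hs, rfl⟩ := hout u w hu hw huw
    replace hs : s < L := hs
    have hne : c ((s + 1) % L) ≠ c s := fun h1 => by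
      have := h.eq_of_eq (Nat.mod_lt _ hL) hs h1
      have := succ_mod_cases hs
      have := h.three_le
      omega
    obtain ⟨u', w', hu', hw', ⟨f', hf'⟩, -, hw's⟩ := exists_adj_of_reflTransGen
      (hG.connectedOn_sdiff (h.mem_vertexSet hs) u ⟨(hZ hu).1, huw.ne⟩ (c ((s + 1) % L))
        ⟨h.mem_vertexSet (Nat.mod_lt _ hL), hne⟩) hu (hCZ _ (Nat.mod_lt _ hL))
    obtain ⟨t, ht, rfl⟩ := hout u' w' hu' hw' ⟨f', hf'⟩
    refine h.hasMinor_cyclePlus_of_ear hfin (A := {c s} ∪ Z) (s := s) (t := t)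
      ((connectedOn_singleton G (c s)).union (connectedOn_reachSet _ _ _) rfl hu (.inr huw.symm))
      ?_ hs ht ?_ (.inl rfl) ?_ ⟨u', .inr hu', hf'⟩ ?_ hk hkL
    · rintro x (rfl | hx)
      · exact h.mem_vertexSet hs
      · exact (hZ hx).1
    · rintro rfl
      exact hw's.2 rfl
    · rintro i hi (hi' | hi')
      · exact h.eq_of_eq hi hs hi'
      · exact (hCZ i hi hi').elim
    · rintro i hi rfl
      have h1 := h.isLink i hi
      rw [h.apply_succ hi] at h1
      obtain rfl | rfl := hf'.left_eq_or_eq h1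
      · exact hCZ _ hi hu'
      · exact hCZ _ (Nat.mod_lt _ hL) hu'
  -- The cycle is spanning, so `f` itself is an ear with both ends on it.
  · push Not at hCV
    obtain ⟨x, y, hxy⟩ := Graph.exists_isLink_of_mem_edgeSet hf
    obtain ⟨s, hs, rfl⟩ := hCV x hxy.left_mem
    obtain ⟨t, ht, rfl⟩ := hCV y hxy.right_mem
    refine h.hasMinor_cyclePlus_of_ear hfin (connectedOn_singleton G (c s)) (s := s) (t := t) ?_ hs
      ht ?_ rfl ?_ ⟨c s, rfl, hxy⟩ hfe hk hkL
    · rintro x rfl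
      exact h.mem_vertexSet hs
    · rintro rfl
      exact hxy.ne rfl
    · exact fun i hi hi' => h.eq_of_eq hi hs hi'

/-! ### Recognising the cycle and the bond. -/

/-- A connected graph all of whose edges lie on one cycle is a cycle. -/
lemma IsCycleSeq.isomorphic_cycle {G : Graph α β} {L : ℕ} {c : ℕ → α} {e : ℕ → β}
    (h : IsCycleSeq G L c e) (hG : Connected G) (hE : ∀ f ∈ E(G), ∃ i < L, f = e i) :
    Isomorphic G (cycle E(G).ncard) := by
  have hL : 0 < L := by have := h.three_le; omega
  have hEL : E(G) = e '' {i | i < L} := by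
    ext f
    constructor
    · intro hf
      obtain ⟨i, hi, rfl⟩ := hE f hf
      exact ⟨i, hi, rfl⟩
    · rintro ⟨i, hi, rfl⟩
      exact (h.isLink i hi).edge_mem
  have hcard : E(G).ncard = L := by
    have hinj : Set.InjOn e {i | i < L} := fun i hi j hj hij => h.injOn_edges hi hj hij
    rw [hEL, hinj.ncard_image]
    have : {i | i < L} = (Finset.range L : Set ℕ) := by ext; simp
    rw [this, Set.ncard_coe_finset, Finset.card_range]
  rw [hcard]
  -- A vertex off the cycle would yield an edge leaving the vertices of the cycle, but every edge is
  -- some `e i`.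
  have hV : ∀ v ∈ V(G), ∃ i < L, c i = v := by
    intro v hv
    by_contra hcon
    obtain ⟨u, w, hu, hw, ⟨f, hf⟩, -⟩ := exists_adj_of_reflTransGen
      (hG.connectedOn (c 0) (h.mem_vertexSet hL) v hv) (T := {v | ∃ i < L, c i = v}) ⟨0, hL, rfl⟩
      hcon
    obtain ⟨i, hi, rfl⟩ := hE f hf.edge_mem
    have h1 := h.isLink i hi
    rw [h.apply_succ hi] at h1
    obtain rfl | rfl := hf.right_eq_or_eq h1
    · exact hw ⟨_, hi, rfl⟩
    · exact hw ⟨_, Nat.mod_lt _ hL, rfl⟩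
  let f : V(cycle L) ≃ V(G) := Equiv.ofBijective (fun i => ⟨c i, h.mem_vertexSet i.2⟩)
    ⟨fun i j hij => Subtype.ext (h.eq_of_eq i.2 j.2 (congrArg Subtype.val hij)), by
      rintro ⟨v, hv⟩
      obtain ⟨i, hi, rfl⟩ := hV v hv
      exact ⟨⟨i, hi⟩, rfl⟩⟩
  let g : E(cycle L) ≃ E(G) := Equiv.ofBijective (fun i => ⟨e i, (h.isLink i i.2).edge_mem⟩)
    ⟨fun i j hij => Subtype.ext (h.injOn_edges i.2 j.2 (congrArg Subtype.val hij)), by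
      rintro ⟨d, hd⟩
      obtain ⟨i, hi, rfl⟩ := hE d hd
      exact ⟨⟨i, hi⟩, rfl⟩⟩
  refine Isomorphic.symm ⟨f, g, ?_⟩
  rintro ⟨i, hi⟩ ⟨x, hx⟩ ⟨y, hy⟩
  replace hi : i < L := hi
  replace hx : x < L := hx
  replace hy : y < L := hy
  have h1 := h.isLink i hi
  rw [h.apply_succ hi] at h1
  change (i < L ∧ ((x = i ∧ y = (i + 1) % L) ∨ (x = (i + 1) % L ∧ y = i))) ↔
    G.IsLink (e i) (c x) (c y)
  constructor
  · rintro ⟨-, ⟨rfl, rfl⟩ | ⟨rfl, rfl⟩⟩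
    · exact h1
    · exact h1.symm
  · intro h2
    refine ⟨hi, ?_⟩
    obtain ⟨h3, h4⟩ | ⟨h3, h4⟩ := h1.eq_and_eq_or_eq_and_eq h2
    · exact .inl ⟨(h.eq_of_eq hi hx h3).symm, (h.eq_of_eq (Nat.mod_lt _ hL) hy h4).symm⟩
    · exact .inr ⟨(h.eq_of_eq (Nat.mod_lt _ hL) hx h4).symm, (h.eq_of_eq hi hy h3).symm⟩

/-- A loopless graph with exactly two vertices is a bond. -/
lemma isomorphic_bond {G : Graph α β} (hG : G.Loopless) (hE : E(G).Finite) {v w : α}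
    (hvw : v ≠ w) (hV : V(G) = {v, w}) : Isomorphic G (bond E(G).ncard) := by
  have := hE.to_subtype
  let g : E(G) ≃ E(bond E(G).ncard) :=
    (Finite.equivFinOfCardEq (Nat.card_coe_set_eq E(G))).trans Fin.equivSubtype
  have hv : v ∈ V(G) := by simp [hV]
  have hw : w ∈ V(G) := by simp [hV]
  have hB : ∀ i : V(bond E(G).ncard), (i : ℕ) = 0 ∨ (i : ℕ) = 1 := fun i => i.2
  let f : V(bond E(G).ncard) ≃ V(G) :=
    Equiv.ofBijective (fun i => if (i : ℕ) = 0 then ⟨v, hv⟩ else ⟨w, hw⟩) ⟨fun i j hij => by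
      apply Subtype.ext
      rcases hB i with hi | hi <;> rcases hB j with hj | hj <;>
        simp [hi, hj, hvw, hvw.symm] at hij ⊢, by
      rintro ⟨x, hx⟩
      rw [hV] at hx
      rcases hx with rfl | rfl
      · exact ⟨⟨0, .inl rfl⟩, rfl⟩
      · exact ⟨⟨1, .inr rfl⟩, rfl⟩⟩
  have hf : ∀ i, (f i : α) = if (i : ℕ) = 0 then v else w := fun i => by
    change ((if (i : ℕ) = 0 then ⟨v, hv⟩ else ⟨w, hw⟩ : V(G)) : α) = _
    split_ifs <;> rfl
  refine Isomorphic.symm ⟨f, g.symm, fun e x y => ?_⟩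
  have hlink : G.IsLink (g.symm e : β) v w := by
    obtain ⟨a, b, hab⟩ := Graph.exists_isLink_of_mem_edgeSet (g.symm e).2
    have ha := hab.left_mem
    have hb := hab.right_mem
    have hne := hab.ne
    rw [hV] at ha hb
    rcases ha with rfl | rfl <;> rcases hb with rfl | rfl
    · exact (hne rfl).elim
    · exact hab
    · exact hab.symm
    · exact (hne rfl).elim
  rw [hf, hf, hlink.isLink_iff]
  have he : (e : ℕ) < E(G).ncard := e.2
  rcases hB x with hx | hx <;> rcases hB y with hy | hy <;>
    simp [bond, hx, hy, he, hvw, hvw.symm]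

end PlaneMinor

/-! ### The theorem. -/

theorem proposition7 (m : ℕ) (hm : 3 ≤ m) :
    ∃ n₂ : ℕ, ∀ G : Graph PlaneMinor.S2 (Set PlaneMinor.S2),
      PlaneMinor.IsPlane G → PlaneMinor.TwoConnected G →
      ∀ n : ℕ, G.edgeSet.ncard = n → n₂ ≤ n →
        ¬ PlaneMinor.HasMinor G (PlaneMinor.cyclePlus (m - 1)) →
        ¬ PlaneMinor.HasMinor G (PlaneMinor.bondPlus (m - 1)) →
        PlaneMinor.Isomorphic G (PlaneMinor.cycle n) ∨
          PlaneMinor.Isomorphic G (PlaneMinor.bond n) := by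
  obtain ⟨k, hk⟩ : ∃ k, k = m - 1 := ⟨_, rfl⟩
  rw [← hk]
  -- One more than the greatest number of edges possible when all degrees are at most `2 * k` and a
  -- ball of radius `2 * k` covers all vertices.
  refine ⟨(1 + 2 * k) ^ (2 * k) * (2 * k) + 1, ?_⟩
  rintro G hP hG n rfl hn hC hB
  have hV := hP.finite_vertexSet
  have hE := hP.finite_edgeSet
  -- Since `G` has at least two vertices, this case means exactly two.
  by_cases h3 : ∃ v ∈ G.vertexSet, ¬ (G.vertexSet \ {v}).Nontrivial
  · obtain ⟨v, hv, h⟩ := h3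
    obtain ⟨w, hw, hwv⟩ := hG.nontrivial.exists_ne v
    refine .inr (PlaneMinor.isomorphic_bond hG.loopless hE hwv.symm ?_)
    rw [Set.not_nontrivial_iff] at h
    ext x
    constructor
    · intro hx
      by_cases hxv : x = v
      · exact .inl hxv
      · exact .inr (h ⟨hx, hxv⟩ ⟨hw, hwv⟩)
    · rintro (rfl | rfl) <;> assumption
  · push Not at h3
    have hd : ∀ v ∈ G.vertexSet, {e | G.Inc e v}.ncard ≤ 2 * k := by
      intro v hv
      by_contra! hlt
      exact hB (PlaneMinor.hasMinor_bondPlus_of_degree hV hG hv (h3 v hv) hlt.le hE)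
    obtain ⟨L, c, e, hkL, hc⟩ := hG.exists_long_isCycleSeq hV hE (D := 2 * k) (by omega) hd hn
    refine .inl (hc.isomorphic_cycle hG.connected fun f hf => ?_)
    by_contra! hfe
    exact hC (hc.hasMinor_cyclePlus hV hG (by omega) hkL hf hfe)
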